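/- Let $(M,g)$ be a compact connected smooth Riemannian manifold (without boundary) of dimension $n$ with strictly negative sectional curvature. Let $\pi:\tilde M\to M$ be its universal cover ($\tilde M$ a simply connected smooth $n$-manifold, $\pi$ a covering map and a local diffeomorphism), and let $G\le \mathrm{Diff}(\tilde M)$ be the group of deck transformations of $\pi$. By a hyperbolic metric on $\tilde M$ we mean a complete Riemannian metric of constant sectional curvature $-1$; for such a metric $\tilde g_{\mathbb H}$ let $G_{\mathbb H}\le \mathrm{Diff}(\tilde M)$ denote its isometry group. All metrics are smooth Riemannian metrics; a smooth homotopy from $g_0$ to $g_1$ is a family of metrics $h(t)$, $t\in[0,1]$, smooth in $(t,x)$ jointly, with $h(0)=g_0$ and $h(1)=g_1$; a metric $k$ on $\tilde M$ is $G$-invariant if $\varphi^*k=k$ for all $\varphi\in G$, and a homotopy is $G$-invariant if every $h(t)$ is. Then the following statements are equivalent: (i) $M$ admits a metric of constant negative sectional curvature. (ii) There is a hyperbolic metric $\tilde g_{\mathbb H}$ on $\tilde M$ which is invariant under $G$. (iii) There is a hyperbolic metric $\tilde g_{\mathbb H}$ on $\tilde M$ such that $G$ is a subgroup of its isometry group $G_{\mathbb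 H}$. (iv) $g$ is smoothly homotopic to a metric on $M$ of constant negative sectional curvature. (v) There is a hyperbolic metric $\tilde g_{\mathbb H}$ on $\tilde M$ such that every $G$-invariant metric on $\tilde M$ is smoothly homotopic to $\tilde g_{\mathbb H}$ through a smooth $G$-invariant homotopy. (For $n\le 1$ the curvature conditions are void.) -/

import Mathlib

open Bundle Manifold Topology Filter Set
open scoped ContDiff ENNReal

noncomputable section

namespace NegCurv

/-- The model space `ℝⁿ`. -/
abbrev Coord (n : ℕ) := EuclideanSpace ℝ (Fin n)

/-- Smooth Riemannian metrics on a smooth `n`-manifold `X` (without boundary). -/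
abbrev Metric (n : ℕ) (X : Type*) [TopologicalSpace X] [ChartedSpace (Coord n) X]
    [IsManifold (𝓡 n) ∞ X] :=
  ContMDiffRiemannianMetric (𝓡 n) ∞ (Coord n) (fun x : X ↦ TangentSpace (𝓡 n) x)

/-- The group `Diff(X)` of smooth diffeomorphisms of `X`. -/
abbrev Diff (n : ℕ) (X : Type*) [TopologicalSpace X] [ChartedSpace (Coord n) X] :=
  X ≃ₘ⟮𝓡 n, 𝓡 n⟯ X

/-! ### Curvature in local coordinates -/

section Coordinates

variable {n : ℕ}

/-- The coordinate vector `∂ᵢ`. -/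
def coordVec (i : Fin n) : Coord n := EuclideanSpace.single i (1 : ℝ)

/-- The partial derivative `∂ᵢ f` at `y`. -/
def partialDeriv (i : Fin n) (f : Coord n → ℝ) (y : Coord n) : ℝ := fderiv ℝ f y (coordVec i)

/-- Christoffel symbols
`Γᵏᵢⱼ = ½ ∑ₗ gᵏˡ (∂ᵢ gⱼₗ + ∂ⱼ gᵢₗ - ∂ₗ gᵢⱼ)` of a field of matrices `g = (gᵢⱼ)`. -/
def christoffel (g : Coord n → Matrix (Fin n) (Fin n) ℝ) (k i j : Fin n) (y : Coord n) : ℝ :=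
  (1 / 2) * ∑ l, (g y)⁻¹ k l *
    (partialDeriv i (fun z ↦ g z j l) y + partialDeriv j (fun z ↦ g z i l) y
      - partialDeriv l (fun z ↦ g z i j) y)

/-- The `l`-th component of `R(∂ᵢ, ∂ⱼ) ∂ₖ`, where
`R(X, Y) Z = ∇_X ∇_Y Z - ∇_Y ∇_X Z - ∇_[X, Y] Z`. -/
def riemannComp (g : Coord n → Matrix (Fin n) (Fin n) ℝ) (l k i j : Fin n) (y : Coord n) : ℝ :=
  partialDeriv i (christoffel g l j k) y - partialDeriv j (christoffel g l i k) y
    + ∑ m, (christoffel g m j k y * christoffel g l i m y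
      - christoffel g m i k y * christoffel g l j m y)

/-- `⟨u, v⟩ = ∑ gᵢⱼ uⁱ vʲ` at `y`. -/
def innerComp (g : Coord n → Matrix (Fin n) (Fin n) ℝ) (y u v : Coord n) : ℝ :=
  ∑ i, ∑ j, g y i j * u i * v j

/-- `⟨R(u, v) v, u⟩` at `y`. -/
def curvatureQuad (g : Coord n → Matrix (Fin n) (Fin n) ℝ) (y u v : Coord n) : ℝ :=
  ∑ i, ∑ j, ∑ k, ∑ l, ∑ p, g y l p * riemannComp g l k i j y * u i * v j * v k * u p

/-- The sectional curvature of the plane spanned by `u, v` at `y` (for linearly independent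
`u, v`): `⟨R(u, v) v, u⟩ / (|u|² |v|² - ⟨u, v⟩²)`. -/
def sectionalComp (g : Coord n → Matrix (Fin n) (Fin n) ℝ) (y u v : Coord n) : ℝ :=
  curvatureQuad g y u v / (innerComp g y u u * innerComp g y v v - innerComp g y u v ^ 2)

end Coordinates

section Manifolds

variable {n : ℕ} {X : Type*} [TopologicalSpace X] [ChartedSpace (Coord n) X]
  [IsManifold (𝓡 n) ∞ X]

/-- The matrix `gᵢⱼ = g(∂ᵢ, ∂ⱼ)` of the metric `g` in the chart `e`, as a function on the target
of `e`. -/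
def metricInChart (g : Metric n X) (e : OpenPartialHomeomorph X (Coord n)) (y : Coord n) :
    Matrix (Fin n) (Fin n) ℝ :=
  Matrix.of fun i j ↦ g.inner (e.symm y) (mfderiv (𝓡 n) (𝓡 n) e.symm y (coordVec i))
    (mfderiv (𝓡 n) (𝓡 n) e.symm y (coordVec j))

/-- All sectional curvatures of `g` are strictly negative. Sectional curvature does not depend on
the chart used to compute it; the condition is imposed in all smooth charts. -/
def HasNegativeCurvature (g : Metric n X) : Prop :=
  ∀ e ∈ IsManifold.maximalAtlas (𝓡 n) ∞ X, ∀ y ∈ e.target, ∀ u v : Coord n,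
    LinearIndependent ℝ ![u, v] → sectionalComp (metricInChart g e) y u v < 0

/-- All sectional curvatures of `g` are equal to `κ`. -/
def HasConstantCurvature (g : Metric n X) (κ : ℝ) : Prop :=
  ∀ e ∈ IsManifold.maximalAtlas (𝓡 n) ∞ X, ∀ y ∈ e.target, ∀ u v : Coord n,
    LinearIndependent ℝ ![u, v] → sectionalComp (metricInChart g e) y u v = κ

/-- The sectional curvature of `g` is a negative constant. -/
def HasConstantNegativeCurvature (g : Metric n X) : Prop :=
  ∃ κ : ℝ, κ < 0 ∧ HasConstantCurvature g κ

/-- The Riemannian distance of `g`: the infimum of the `g`-lengths of `C¹` paths. -/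
def riemDist (g : Metric n X) (x y : X) : ℝ≥0∞ :=
  letI : RiemannianBundle (fun x : X ↦ TangentSpace (𝓡 n) x) := ⟨g.toRiemannianMetric⟩
  riemannianEDist (𝓡 n) x y

/-- `g` is complete: Cauchy sequences for the Riemannian distance converge. -/
def IsCompleteMetric (g : Metric n X) : Prop :=
  ∀ s : ℕ → X, (∀ ε : ℝ≥0∞, 0 < ε → ∃ N, ∀ i ≥ N, ∀ j ≥ N, riemDist g (s i) (s j) < ε) →
    ∃ x, Tendsto s atTop (𝓝 x)

/-- Hyperbolic metrics on a simply connected manifold: complete metrics of constant sectional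
curvature `-1`. -/
def IsHyperbolic (g : Metric n X) : Prop :=
  IsCompleteMetric g ∧ HasConstantCurvature g (-1)

/-- `φ^* g = g`. -/
def Preserves (φ : Diff n X) (g : Metric n X) : Prop :=
  ∀ (x : X) (u v : TangentSpace (𝓡 n) x),
    g.inner (φ x) (mfderiv (𝓡 n) (𝓡 n) φ x u) (mfderiv (𝓡 n) (𝓡 n) φ x v) = g.inner x u v

/-- A smooth homotopy of Riemannian metrics from `g₀` to `g₁`: metrics `h t`, `t ∈ [0, 1]`, with
`(t, x) ↦ h t x` smooth on `[0, 1] × X`, `h 0 = g₀` and `h 1 = g₁`. -/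
structure IsSmoothHomotopy (h : unitInterval → Metric n X) (g₀ g₁ : Metric n X) : Prop where
  smooth : ContMDiff ((𝓡∂ 1).prod (𝓡 n))
    ((𝓡 n).prod 𝓘(ℝ, Coord n →L[ℝ] Coord n →L[ℝ] ℝ)) ∞
    (fun p : unitInterval × X ↦ (TotalSpace.mk' (Coord n →L[ℝ] Coord n →L[ℝ] ℝ) p.2
      ((h p.1).inner p.2) : TotalSpace (Coord n →L[ℝ] Coord n →L[ℝ] ℝ)
        (fun x : X ↦ TangentSpace (𝓡 n) x →L[ℝ] TangentSpace (𝓡 n) x →L[ℝ] ℝ)))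
  zero : h 0 = g₀
  one : h 1 = g₁

end Manifolds

section Groups

variable {n : ℕ} {X : Type*} [TopologicalSpace X] [ChartedSpace (Coord n) X]

instance : Group (Diff n X) where
  mul φ ψ := ψ.trans φ
  one := Diffeomorph.refl (𝓡 n) X ∞
  inv φ := φ.symm
  mul_assoc _ _ _ := rfl
  one_mul _ := rfl
  mul_one _ := rfl
  inv_mul_cancel φ := Diffeomorph.ext fun x ↦ φ.symm_apply_apply x

theorem mul_apply (φ ψ : Diff n X) (x : X) : (φ * ψ) x = φ (ψ x) := rfl

theorem one_apply (x : X) : (1 : Diff n X) x = x := rfl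

theorem apply_inv_apply (φ : Diff n X) (x : X) : φ (φ⁻¹ x) = x := φ.apply_symm_apply x

theorem preserves_one [IsManifold (𝓡 n) ∞ X] (g : Metric n X) : Preserves 1 g := by
  intro x u v
  have h : mfderiv (𝓡 n) (𝓡 n) (⇑(1 : Diff n X)) x = ContinuousLinearMap.id ℝ _ := mfderiv_id
  rw [h]
  rfl

theorem Preserves.mul [IsManifold (𝓡 n) ∞ X] {g : Metric n X} {φ ψ : Diff n X}
    (hφ : Preserves φ g) (hψ : Preserves ψ g) : Preserves (φ * ψ) g := by
  intro x u v
  have h : mfderiv (𝓡 n) (𝓡 n) (⇑(φ * ψ)) x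
      = (mfderiv (𝓡 n) (𝓡 n) φ (ψ x)).comp (mfderiv (𝓡 n) (𝓡 n) ψ x) :=
    mfderiv_comp x (φ.mdifferentiable (by simp) (ψ x)) (ψ.mdifferentiable (by simp) x)
  rw [h]
  exact (hφ (ψ x) _ _).trans (hψ x u v)

theorem Preserves.inv [IsManifold (𝓡 n) ∞ X] {g : Metric n X} {φ : Diff n X}
    (hφ : Preserves φ g) : Preserves φ⁻¹ g := by
  intro x u v
  have h1 := mfderiv_comp x (φ.mdifferentiable (by simp) (φ⁻¹ x))
    ((φ⁻¹ : Diff n X).mdifferentiable (by simp) x)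
  have h2 : (⇑φ ∘ ⇑(φ⁻¹ : Diff n X)) = id := funext fun y ↦ apply_inv_apply φ y
  have h3 : ∀ w : TangentSpace (𝓡 n) x, mfderiv (𝓡 n) (𝓡 n) φ (φ⁻¹ x)
      (mfderiv (𝓡 n) (𝓡 n) (⇑(φ⁻¹ : Diff n X)) x w) = w := by
    intro w
    have h4 : mfderiv (𝓡 n) (𝓡 n) (⇑φ ∘ ⇑(φ⁻¹ : Diff n X)) x w = w := by
      rw [h2, mfderiv_id]; rfl
    rw [h1] at h4
    exact h4
  have h5 := hφ (φ⁻¹ x) (mfderiv (𝓡 n) (𝓡 n) (⇑(φ⁻¹ : Diff n X)) x u)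
    (mfderiv (𝓡 n) (𝓡 n) (⇑(φ⁻¹ : Diff n X)) x v)
  rw [← h5, h3, h3, apply_inv_apply]

/-- The isometry group of `(X, g)`, as a subgroup of `Diff(X)`. -/
def isometryGroup [IsManifold (𝓡 n) ∞ X] (g : Metric n X) : Subgroup (Diff n X) where
  carrier := {φ | Preserves φ g}
  mul_mem' hφ hψ := hφ.mul hψ
  one_mem' := preserves_one g
  inv_mem' hφ := hφ.inv

/-- The deck transformation group of `proj : X → M`, as a subgroup of `Diff(X)`. (When `proj` is a
covering and a local diffeomorphism, every continuous deck transformation is smooth.) -/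
def deckGroup (n : ℕ) {X M : Type*} [TopologicalSpace X] [ChartedSpace (Coord n) X]
    (proj : X → M) : Subgroup (Diff n X) where
  carrier := {φ | ∀ x, proj (φ x) = proj x}
  mul_mem' {φ ψ} hφ hψ x := (hφ (ψ x)).trans (hψ x)
  one_mem' _ := rfl
  inv_mem' {φ} hφ x := by
    have h := hφ (φ⁻¹ x)
    rw [apply_inv_apply] at h
    exact h.symm

/-- The metric `g` is invariant under the group `G` of diffeomorphisms. -/
def IsInvariant [IsManifold (𝓡 n) ∞ X] (G : Subgroup (Diff n X)) (g : Metric n X) : Prop :=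
  ∀ φ ∈ G, Preserves φ g

end Groups

end NegCurv

end

/-!
Riemannian metrics on a manifold form a convex set: if `g₀` and `g₁` are metrics, then so is
`(1 - t) g₀ + t g₁` for `t ∈ [0, 1]`, this family is a smooth homotopy
(`NegCurv.isSmoothHomotopy_convexComb`), and it is invariant under every diffeomorphism that
preserves both ends. Hence a metric of constant negative curvature on `M`, or an invariant
hyperbolic metric on the universal cover, is reached from any other (invariant) metric as soon as
it exists. Conversely, a hyperbolic metric that is joined by an invariant homotopy to some
invariant metric, for instance to the pullback of `g`, is invariant itself, being an end of the
homotopy.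

What remains is to pass between `M` and its universal cover.

* Going up (`NegCurv.HasConstantNegativeCurvature.exists_isHyperbolic`): a metric of constant
  curvature `κ < 0`, multiplied by `-κ`, has curvature `-1`; its pullback is invariant under deck
  transformations, has curvature `-1` since the covering is a local isometry, and is complete
  because `M` is compact (`NegCurv.IsPullback.isCompleteMetric`).
* Going down (`NegCurv.exists_isPullback_of_invariant`): since the cover is simply connected, the
  deck transformations act transitively on the fibres
  (`NegCurv.exists_mem_deckGroup_apply_eq`). An invariant metric therefore induces the same inner
  product on a tangent space of `M` through all points of the fibre, and local sections of the
  covering show that the resulting metric is smooth.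

Smoothness of pullbacks is checked on the coordinate expression of a field of bilinear forms
(`NegCurv.contMDiffAt_form_iff`). Curvature is compared by transporting charts along the local
diffeomorphism, so that both metrics have the same coordinate matrix near the point
(`NegCurv.IsPullback.metricInChart_eventuallyEq`).
-/

namespace NegCurv

/-! ### Bilinear forms on tangent spaces -/

/-- The unit ball of a positive definite bilinear form on a finite-dimensional space is bounded,
because the form attains a positive minimum on the unit sphere. -/
theorem isVonNBounded_of_posDef {E : Type*} [NormedAddCommGroup E] [NormedSpace ℝ E]
    [FiniteDimensional ℝ E] (B : E →L[ℝ] E →L[ℝ] ℝ) (hB : ∀ v, v ≠ 0 → 0 < B v v) :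
    Bornology.IsVonNBounded ℝ {v : E | B v v < 1} := by
  rcases subsingleton_or_nontrivial E with h | h
  · exact NormedSpace.isVonNBounded_of_isBounded _ (Set.toFinite _).isBounded
  have : ProperSpace E := FiniteDimensional.proper_real E
  obtain ⟨w, hw, hmin⟩ := (isCompact_sphere (0 : E) 1).exists_isMinOn
    (NormedSpace.sphere_nonempty.2 zero_le_one)
    (f := fun v ↦ B v v) (B.continuous.clm_apply continuous_id).continuousOn
  have hw0 : w ≠ 0 := by rintro rfl; simp at hw
  -- The ball has radius at most `(B w w)^(-1/2)`, which is at most `(B w w)⁻¹ + 1`.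
  refine NormedSpace.isVonNBounded_of_isBounded _
    ((Metric.isBounded_closedBall (x := (0 : E)) (r := (B w w)⁻¹ + 1)).subset ?_)
  intro v hv
  have hm := hB w hw0
  have hv1 : B v v < 1 := hv
  rw [mem_closedBall_zero_iff]
  rcases eq_or_ne v 0 with rfl | hv0
  · simp; positivity
  have hnv : 0 < ‖v‖ := norm_pos_iff.2 hv0
  have h1 : B w w ≤ B (‖v‖⁻¹ • v) (‖v‖⁻¹ • v) :=
    hmin (by simp [norm_smul, hnv.ne'])
  simp only [map_smul, smul_apply, smul_eq_mul] at h1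
  have h2 : B w w * ‖v‖ ^ 2 ≤ B v v := by
    calc B w w * ‖v‖ ^ 2 ≤ (‖v‖⁻¹ * (‖v‖⁻¹ * B v v)) * ‖v‖ ^ 2 := by gcongr
      _ = B v v := by field_simp
  have h3 : ‖v‖ ^ 2 ≤ (B w w)⁻¹ := by
    rw [← one_div, le_div_iff₀ hm]; linarith
  nlinarith [sq_nonneg (‖v‖ - 1)]

section Forms

variable {n : ℕ} {X Y : Type*} [TopologicalSpace X] [ChartedSpace (Coord n) X]
  [TopologicalSpace Y] [ChartedSpace (Coord n) Y]

/-- Continuous bilinear forms on the tangent space at `x`. -/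
abbrev Form (n : ℕ) {X : Type*} [TopologicalSpace X] [ChartedSpace (Coord n) X] (x : X) :=
  TangentSpace (𝓡 n) x →L[ℝ] TangentSpace (𝓡 n) x →L[ℝ] ℝ

/-- The pullback `(u, v) ↦ B (A u) (A v)` of a bilinear form along a linear map. -/
noncomputable def pullForm {x : X} {y : Y}
    (A : TangentSpace (𝓡 n) x →L[ℝ] TangentSpace (𝓡 n) y) (B : Form n y) : Form n x :=
  (ContinuousLinearMap.precomp ℝ A).comp (B.comp A)

@[simp] theorem pullForm_apply {x : X} {y : Y}
    (A : TangentSpace (𝓡 n) x →L[ℝ] TangentSpace (𝓡 n) y) (B : Form n y)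
    (u v : TangentSpace (𝓡 n) x) : pullForm A B u v = B (A u) (A v) := rfl

theorem isVonNBounded_of_pos {x : X} (B : Form n x) (hB : ∀ v, v ≠ 0 → 0 < B v v) :
    Bornology.IsVonNBounded ℝ {v : TangentSpace (𝓡 n) x | B v v < 1} :=
  isVonNBounded_of_posDef (E := Coord n) B hB

variable [IsManifold (𝓡 n) ∞ X] [IsManifold (𝓡 n) ∞ Y]

/-- The bilinear form `B` on the tangent space at `x`, read in the tangent coordinates given by the
preferred chart at `x₀`. -/
noncomputable def coordForm (x₀ : X) {x : X} (B : Form n x) : Coord n →L[ℝ] Coord n →L[ℝ] ℝ :=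
  ContinuousLinearMap.inCoordinates (Coord n) (fun x : X ↦ TangentSpace (𝓡 n) x)
    (Coord n →L[ℝ] ℝ) (fun x : X ↦ TangentSpace (𝓡 n) x →L[ℝ] ℝ) x₀ x x₀ x B

/-- On the domain of the chart at `x₀`, the coordinate expression of a form is obtained by moving
coordinate vectors to the tangent space at `x`. -/
theorem coordForm_apply {x₀ x : X} (hx : x ∈ (chartAt (Coord n) x₀).source) (B : Form n x)
    (u v : Coord n) : coordForm x₀ B u v =
      B ((trivializationAt (Coord n) (fun x : X ↦ TangentSpace (𝓡 n) x) x₀).symm x u)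
        ((trivializationAt (Coord n) (fun x : X ↦ TangentSpace (𝓡 n) x) x₀).symm x v) := by
  unfold coordForm
  have := inCoordinates_apply_eq₂ (𝕜 := ℝ) (F₁ := Coord n) (E₁ := fun x : X ↦ TangentSpace (𝓡 n) x)
    (F₂ := Coord n) (E₂ := fun x : X ↦ TangentSpace (𝓡 n) x) (F₃ := ℝ)
    (E₃ := fun _ : X ↦ ℝ) (x₀ := x₀) (x := x) (ϕ := B) (v := u) (w := v)
    (by simpa using hx) (by simpa using hx) (by simp)
  refine this.trans ?_
  simp

variable {E H N : Type*} [NormedAddCommGroup E] [NormedSpace ℝ E] [TopologicalSpace H]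
  {I : ModelWithCorners ℝ E H} [TopologicalSpace N] [ChartedSpace H N]

/-- A field of bilinear forms along a map `b` is smooth if and only if `b` is smooth and the
coordinate expression of the field is smooth. -/
theorem contMDiffAt_form_iff {b : N → X} {ψ : ∀ m, Form n (b m)} {m₀ : N} :
    ContMDiffAt I ((𝓡 n).prod 𝓘(ℝ, Coord n →L[ℝ] Coord n →L[ℝ] ℝ)) ∞
      (fun m ↦ (TotalSpace.mk' (Coord n →L[ℝ] Coord n →L[ℝ] ℝ) (b m) (ψ m) :
        TotalSpace (Coord n →L[ℝ] Coord n →L[ℝ] ℝ) (fun x : X ↦ Form n x))) m₀ ↔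
    ContMDiffAt I (𝓡 n) ∞ b m₀ ∧
      ContMDiffAt I 𝓘(ℝ, Coord n →L[ℝ] Coord n →L[ℝ] ℝ) ∞
        (fun m ↦ coordForm (b m₀) (ψ m)) m₀ :=
  contMDiffAt_hom_bundle _

end Forms

/-! ### Smooth fields of bilinear forms -/

section Smooth

variable {n : ℕ} {X Y : Type*} [TopologicalSpace X] [ChartedSpace (Coord n) X]
  [IsManifold (𝓡 n) ∞ X] [TopologicalSpace Y] [ChartedSpace (Coord n) Y] [IsManifold (𝓡 n) ∞ Y]
  {E H N : Type*} [NormedAddCommGroup E] [NormedSpace ℝ E] [TopologicalSpace H]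
  {I : ModelWithCorners ℝ E H} [TopologicalSpace N] [ChartedSpace H N]

theorem coordForm_add (x₀ : X) {x : X} (B C : Form n x) :
    coordForm x₀ (B + C) = coordForm x₀ B + coordForm x₀ C := by
  simp only [coordForm, ContinuousLinearMap.inCoordinates, ContinuousLinearMap.add_comp,
    ContinuousLinearMap.comp_add]

theorem coordForm_smul (x₀ : X) {x : X} (c : ℝ) (B : Form n x) :
    coordForm x₀ (c • B) = c • coordForm x₀ B := by
  simp only [coordForm, ContinuousLinearMap.inCoordinates, ContinuousLinearMap.smul_comp,
    ContinuousLinearMap.comp_smul]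

theorem contMDiffAt_form_add {b : N → X} {φ ψ : ∀ m, Form n (b m)} {m₀ : N}
    (hφ : ContMDiffAt I ((𝓡 n).prod 𝓘(ℝ, Coord n →L[ℝ] Coord n →L[ℝ] ℝ)) ∞
      (fun m ↦ (TotalSpace.mk' (Coord n →L[ℝ] Coord n →L[ℝ] ℝ) (b m) (φ m) :
        TotalSpace (Coord n →L[ℝ] Coord n →L[ℝ] ℝ) (fun x : X ↦ Form n x))) m₀)
    (hψ : ContMDiffAt I ((𝓡 n).prod 𝓘(ℝ, Coord n →L[ℝ] Coord n →L[ℝ] ℝ)) ∞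
      (fun m ↦ (TotalSpace.mk' (Coord n →L[ℝ] Coord n →L[ℝ] ℝ) (b m) (ψ m) :
        TotalSpace (Coord n →L[ℝ] Coord n →L[ℝ] ℝ) (fun x : X ↦ Form n x))) m₀) :
    ContMDiffAt I ((𝓡 n).prod 𝓘(ℝ, Coord n →L[ℝ] Coord n →L[ℝ] ℝ)) ∞
      (fun m ↦ (TotalSpace.mk' (Coord n →L[ℝ] Coord n →L[ℝ] ℝ) (b m) (φ m + ψ m) :
        TotalSpace (Coord n →L[ℝ] Coord n →L[ℝ] ℝ) (fun x : X ↦ Form n x))) m₀ := by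
  rw [contMDiffAt_form_iff] at hφ hψ ⊢
  simp only [coordForm_add]
  exact ⟨hφ.1, hφ.2.add hψ.2⟩

theorem contMDiffAt_form_smul {b : N → X} {c : N → ℝ} {φ : ∀ m, Form n (b m)} {m₀ : N}
    (hc : ContMDiffAt I 𝓘(ℝ, ℝ) ∞ c m₀)
    (hφ : ContMDiffAt I ((𝓡 n).prod 𝓘(ℝ, Coord n →L[ℝ] Coord n →L[ℝ] ℝ)) ∞
      (fun m ↦ (TotalSpace.mk' (Coord n →L[ℝ] Coord n →L[ℝ] ℝ) (b m) (φ m) :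
        TotalSpace (Coord n →L[ℝ] Coord n →L[ℝ] ℝ) (fun x : X ↦ Form n x))) m₀) :
    ContMDiffAt I ((𝓡 n).prod 𝓘(ℝ, Coord n →L[ℝ] Coord n →L[ℝ] ℝ)) ∞
      (fun m ↦ (TotalSpace.mk' (Coord n →L[ℝ] Coord n →L[ℝ] ℝ) (b m) (c m • φ m) :
        TotalSpace (Coord n →L[ℝ] Coord n →L[ℝ] ℝ) (fun x : X ↦ Form n x))) m₀ := by
  rw [contMDiffAt_form_iff] at hφ ⊢
  simp only [coordForm_smul]
  exact ⟨hφ.1, hc.smul hφ.2⟩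

/-- In tangent coordinates, pulling back along the derivative of `f` is pulling back along the
coordinate expression of that derivative. -/
theorem coordForm_pullForm_mfderiv {f : X → Y} {x₀ x : X}
    (hx : x ∈ (chartAt (Coord n) x₀).source) (hfx : f x ∈ (chartAt (Coord n) (f x₀)).source)
    (B : Form n (f x)) :
    coordForm x₀ (pullForm (mfderiv (𝓡 n) (𝓡 n) f x) B) =
      ((inTangentCoordinates (𝓡 n) (𝓡 n) id f (mfderiv (𝓡 n) (𝓡 n) f) x₀ x).precomp ℝ).comp
        ((coordForm (f x₀) B).comp
          (inTangentCoordinates (𝓡 n) (𝓡 n) id f (mfderiv (𝓡 n) (𝓡 n) f) x₀ x)) := by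
  have hx' : x ∈ (trivializationAt (Coord n) (fun x : X ↦ TangentSpace (𝓡 n) x) x₀).baseSet := by
    simpa using hx
  have hfx' : f x ∈
      (trivializationAt (Coord n) (fun y : Y ↦ TangentSpace (𝓡 n) y) (f x₀)).baseSet := by
    simpa using hfx
  have key : ∀ u : Coord n,
      (trivializationAt (Coord n) (fun y : Y ↦ TangentSpace (𝓡 n) y) (f x₀)).symm (f x)
        (inTangentCoordinates (𝓡 n) (𝓡 n) id f (mfderiv (𝓡 n) (𝓡 n) f) x₀ x u) =
      mfderiv (𝓡 n) (𝓡 n) f x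
        ((trivializationAt (Coord n) (fun x : X ↦ TangentSpace (𝓡 n) x) x₀).symm x u) := by
    intro u
    have h := (trivializationAt (Coord n) (fun y : Y ↦ TangentSpace (𝓡 n) y) (f x₀)
      ).symmL_continuousLinearMapAt (R := ℝ) hfx' (mfderiv (𝓡 n) (𝓡 n) f x
        ((trivializationAt (Coord n) (fun x : X ↦ TangentSpace (𝓡 n) x) x₀).symm x u))
    have h1 : inTangentCoordinates (𝓡 n) (𝓡 n) id f (mfderiv (𝓡 n) (𝓡 n) f) x₀ x u =
      (trivializationAt (Coord n) (fun y : Y ↦ TangentSpace (𝓡 n) y) (f x₀)).continuousLinearMapAt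
        ℝ (f x) (mfderiv (𝓡 n) (𝓡 n) f x
          ((trivializationAt (Coord n) (fun x : X ↦ TangentSpace (𝓡 n) x) x₀).symmL ℝ x u)) := rfl
    rw [h1, Trivialization.symmL_apply _ hx']
    exact (Trivialization.symmL_apply (R := ℝ) _ hfx' _).symm.trans h
  ext u v
  rw [coordForm_apply hx, pullForm_apply, ← key, ← key, ← coordForm_apply hfx]
  rfl

/-- The pullback of a smooth field of bilinear forms by a smooth map is smooth. -/
theorem contMDiffAt_pullForm {f : X → Y} {x₀ : X} {s : ∀ y : Y, Form n y}
    (hf : ContMDiffAt (𝓡 n) (𝓡 n) ∞ f x₀)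
    (hs : ContMDiffAt (𝓡 n) ((𝓡 n).prod 𝓘(ℝ, Coord n →L[ℝ] Coord n →L[ℝ] ℝ)) ∞
      (fun y ↦ (TotalSpace.mk' (Coord n →L[ℝ] Coord n →L[ℝ] ℝ) y (s y) :
        TotalSpace (Coord n →L[ℝ] Coord n →L[ℝ] ℝ) (fun y : Y ↦ Form n y))) (f x₀)) :
    ContMDiffAt (𝓡 n) ((𝓡 n).prod 𝓘(ℝ, Coord n →L[ℝ] Coord n →L[ℝ] ℝ)) ∞
      (fun x ↦ (TotalSpace.mk' (Coord n →L[ℝ] Coord n →L[ℝ] ℝ) x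
        (pullForm (mfderiv (𝓡 n) (𝓡 n) f x) (s (f x))) :
        TotalSpace (Coord n →L[ℝ] Coord n →L[ℝ] ℝ) (fun x : X ↦ Form n x))) x₀ := by
  rw [contMDiffAt_form_iff] at hs ⊢
  refine ⟨contMDiffAt_id, ?_⟩
  have hD : ContMDiffAt (𝓡 n) 𝓘(ℝ, Coord n →L[ℝ] Coord n) ∞
      (inTangentCoordinates (𝓡 n) (𝓡 n) id f (mfderiv (𝓡 n) (𝓡 n) f) x₀) x₀ :=
    hf.mfderiv_const (by simp)
  have hB : ContMDiffAt (𝓡 n) 𝓘(ℝ, Coord n →L[ℝ] Coord n →L[ℝ] ℝ) ∞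
      (fun x ↦ coordForm (f x₀) (s (f x))) x₀ := hs.2.comp x₀ hf
  have hP : ContMDiffAt (𝓡 n) 𝓘(ℝ, (Coord n →L[ℝ] ℝ) →L[ℝ] (Coord n →L[ℝ] ℝ)) ∞
      (fun x ↦ (inTangentCoordinates (𝓡 n) (𝓡 n) id f (mfderiv (𝓡 n) (𝓡 n) f) x₀ x).precomp ℝ)
      x₀ := hD.clm_precomp
  refine (hP.clm_comp (hB.clm_comp hD)).congr_of_eventuallyEq ?_
  filter_upwards [(chartAt (Coord n) x₀).open_source.mem_nhds (mem_chart_source _ x₀),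
    hf.continuousAt ((chartAt (Coord n) (f x₀)).open_source.mem_nhds (mem_chart_source _ (f x₀)))]
    with x hx hfx
  exact coordForm_pullForm_mfderiv hx hfx _

end Smooth

/-! ### Constructions of metrics -/

section Metrics

variable {n : ℕ} {X Y : Type*} [TopologicalSpace X] [ChartedSpace (Coord n) X]
  [IsManifold (𝓡 n) ∞ X] [TopologicalSpace Y] [ChartedSpace (Coord n) Y] [IsManifold (𝓡 n) ∞ Y]

/-- The metric given by a smooth field of positive definite symmetric bilinear forms. -/
noncomputable def Metric.ofForms (B : ∀ x : X, Form n x) (symm : ∀ x u v, B x u v = B x v u)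
    (pos : ∀ x v, v ≠ 0 → 0 < B x v v)
    (smooth : ContMDiff (𝓡 n) ((𝓡 n).prod 𝓘(ℝ, Coord n →L[ℝ] Coord n →L[ℝ] ℝ)) ∞
      (fun x ↦ (TotalSpace.mk' (Coord n →L[ℝ] Coord n →L[ℝ] ℝ) x (B x) :
        TotalSpace (Coord n →L[ℝ] Coord n →L[ℝ] ℝ) (fun x : X ↦ Form n x)))) : Metric n X where
  inner := B
  symm := symm
  pos := pos
  isVonNBounded x := isVonNBounded_of_pos (B x) (pos x)
  contMDiff := smooth

/-- Scaling of a metric by a positive constant. -/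
noncomputable def Metric.scale (g : Metric n X) (c : ℝ) (hc : 0 < c) : Metric n X :=
  Metric.ofForms (fun x ↦ c • g.inner x)
    (fun x u v ↦ congrArg (c * ·) (g.symm x u v))
    (fun x v hv ↦ mul_pos hc (g.pos x v hv))
    (fun x ↦ contMDiffAt_form_smul contMDiffAt_const (g.contMDiff x))

/-- The metric `(1 - t) g₀ + t g₁`, `t ∈ [0, 1]`. -/
noncomputable def Metric.convexComb (g₀ g₁ : Metric n X) (t : unitInterval) : Metric n X :=
  Metric.ofForms (fun x ↦ (1 - (t : ℝ)) • g₀.inner x + (t : ℝ) • g₁.inner x)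
    (fun x u v ↦ congrArg₂ (fun a b ↦ (1 - (t : ℝ)) * a + (t : ℝ) * b) (g₀.symm x u v)
      (g₁.symm x u v))
    (fun x v hv ↦ by
      have h0 := g₀.pos x v hv
      have h1 := g₁.pos x v hv
      have ht := t.2.1
      have ht' := t.2.2
      change 0 < (1 - (t : ℝ)) * g₀.inner x v v + (t : ℝ) * g₁.inner x v v
      rcases ht.eq_or_lt with h | h
      · rw [← h]; simpa using h0
      · exact add_pos_of_nonneg_of_pos (mul_nonneg (by linarith) h0.le) (mul_pos h h1))
    (fun x ↦ contMDiffAt_form_add (contMDiffAt_form_smul contMDiffAt_const (g₀.contMDiff x))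
      (contMDiffAt_form_smul contMDiffAt_const (g₁.contMDiff x)))

theorem Metric.ext_inner {g g' : Metric n X} (h : ∀ x, g.inner x = g'.inner x) : g = g' := by
  cases g; cases g'
  congr
  exact funext h

/-- The straight segment between two metrics is a smooth homotopy. -/
theorem isSmoothHomotopy_convexComb (g₀ g₁ : Metric n X) :
    IsSmoothHomotopy (g₀.convexComb g₁) g₀ g₁ where
  smooth p := by
    have ht : ContMDiffAt ((𝓡∂ 1).prod (𝓡 n)) 𝓘(ℝ, ℝ) ∞
        (fun p : unitInterval × X ↦ (p.1 : ℝ)) p :=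
      (contMDiff_subtypeVal_Icc _).comp p contMDiffAt_fst
    have h : ∀ g : Metric n X, ContMDiffAt ((𝓡∂ 1).prod (𝓡 n))
        ((𝓡 n).prod 𝓘(ℝ, Coord n →L[ℝ] Coord n →L[ℝ] ℝ)) ∞
        (fun p : unitInterval × X ↦ (TotalSpace.mk' (Coord n →L[ℝ] Coord n →L[ℝ] ℝ) p.2
          (g.inner p.2) : TotalSpace (Coord n →L[ℝ] Coord n →L[ℝ] ℝ) (fun x : X ↦ Form n x))) p :=
      fun g ↦ (g.contMDiff p.2).comp p contMDiffAt_snd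
    exact contMDiffAt_form_add (contMDiffAt_form_smul (contMDiffAt_const.sub ht) (h g₀))
      (contMDiffAt_form_smul ht (h g₁))
  zero := Metric.ext_inner fun x ↦ by
    ext u v
    change (1 - (0 : ℝ)) * g₀.inner x u v + 0 * g₁.inner x u v = g₀.inner x u v
    ring
  one := Metric.ext_inner fun x ↦ by
    ext u v
    change (1 - (1 : ℝ)) * g₀.inner x u v + 1 * g₁.inner x u v = g₁.inner x u v
    ring

theorem Preserves.convexComb {φ : Diff n X} {g₀ g₁ : Metric n X} (h₀ : Preserves φ g₀)
    (h₁ : Preserves φ g₁) (t : unitInterval) : Preserves φ (g₀.convexComb g₁ t) :=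
  fun x u v ↦ congrArg₂ (fun a b ↦ (1 - (t : ℝ)) * a + (t : ℝ) * b) (h₀ x u v) (h₁ x u v)

/-- `g' = f^* g`. -/
def IsPullback (f : X → Y) (g' : Metric n X) (g : Metric n Y) : Prop :=
  ∀ x, g'.inner x = pullForm (mfderiv (𝓡 n) (𝓡 n) f x) (g.inner (f x))

/-- The pullback of a metric by a local diffeomorphism. -/
theorem exists_isPullback {f : X → Y} (hf : IsLocalDiffeomorph (𝓡 n) (𝓡 n) ∞ f) (g : Metric n Y) :
    ∃ g' : Metric n X, IsPullback f g' g :=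
  ⟨Metric.ofForms (fun x ↦ pullForm (mfderiv (𝓡 n) (𝓡 n) f x) (g.inner (f x)))
    (fun x u v ↦ g.symm (f x) _ _)
    (fun x v hv ↦ g.pos (f x) _
      ((hf.mfderivToContinuousLinearEquiv (by simp) x).map_ne_zero_iff.2 hv))
    (fun x ↦ contMDiffAt_pullForm (hf.contMDiff x) (g.contMDiff (f x))), fun _ ↦ rfl⟩

/-- The pullback of a metric along `f` is preserved by the deck transformations of `f`. -/
theorem IsPullback.preserves_of_comp_eq {f : X → Y} (hf : IsLocalDiffeomorph (𝓡 n) (𝓡 n) ∞ f)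
    {g' : Metric n X} {g : Metric n Y} (h : IsPullback f g' g) {φ : Diff n X}
    (hφ : ∀ x, f (φ x) = f x) : Preserves φ g' := by
  intro x u v
  have h2 : mfderiv (𝓡 n) (𝓡 n) f x =
      (mfderiv (𝓡 n) (𝓡 n) f (φ x)).comp (mfderiv (𝓡 n) (𝓡 n) φ x) := by
    rw [← mfderiv_comp x (hf.mdifferentiable (by simp) _) (φ.mdifferentiable (by simp) x)]
    congr 1
    exact (funext hφ).symm
  rw [h (φ x), h x, h2, pullForm_apply]
  rw [hφ]
  rfl

/-- A metric upstairs that is invariant under a group acting transitively on the fibres of a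
surjective local diffeomorphism descends. -/
theorem exists_isPullback_of_invariant {f : X → Y} (hf : IsLocalDiffeomorph (𝓡 n) (𝓡 n) ∞ f)
    (hsurj : Function.Surjective f)
    (htrans : ∀ x x', f x = f x' → ∃ φ ∈ deckGroup n f, φ x = x') {g' : Metric n X}
    (hg' : IsInvariant (deckGroup n f) g') : ∃ g : Metric n Y, IsPullback f g' g := by
  choose s hs using hsurj
  let e (x : X) : TangentSpace (𝓡 n) x ≃L[ℝ] TangentSpace (𝓡 n) (f x) :=
    hf.mfderivToContinuousLinearEquiv (by simp) x
  -- The tangent spaces at `p` and at `f (s p)` are definitionally equal.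
  let A (p : Y) : TangentSpace (𝓡 n) p →L[ℝ] TangentSpace (𝓡 n) (s p) :=
    ((e (s p)).symm : TangentSpace (𝓡 n) (f (s p)) →L[ℝ] TangentSpace (𝓡 n) (s p))
  let B (p : Y) : Form n p := pullForm (A p) (g'.inner (s p))
  -- Transporting by a deck transformation shows that the choice of `s` does not matter.
  have aux : ∀ x y, f x = f y → ∀ u v : TangentSpace (𝓡 n) x,
      g'.inner y ((e y).symm (mfderiv (𝓡 n) (𝓡 n) f x u))
        ((e y).symm (mfderiv (𝓡 n) (𝓡 n) f x v)) = g'.inner x u v := by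
    intro x y hxy u v
    obtain ⟨φ, hφ, rfl⟩ := htrans x y hxy
    have h2 : mfderiv (𝓡 n) (𝓡 n) f x =
        (mfderiv (𝓡 n) (𝓡 n) f (φ x)).comp (mfderiv (𝓡 n) (𝓡 n) φ x) := by
      rw [← mfderiv_comp x (hf.mdifferentiable (by simp) _) (φ.mdifferentiable (by simp) x)]
      congr 1
      exact (funext hφ).symm
    have h3 : ∀ w : TangentSpace (𝓡 n) x, (e (φ x)).symm (mfderiv (𝓡 n) (𝓡 n) f x w) =
        mfderiv (𝓡 n) (𝓡 n) φ x w := by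
      intro w
      rw [h2]
      exact (e (φ x)).symm_apply_apply _
    rw [h3, h3]
    exact hg' φ hφ x u v
  have hB : ∀ x, g'.inner x = pullForm (mfderiv (𝓡 n) (𝓡 n) f x) (B (f x)) := by
    intro x
    ext u v
    exact (aux x (s (f x)) (hs (f x)).symm u v).symm
  have hBeq : ∀ p q : Y, p = q → ∀ u v : Coord n, B p u v = B q u v := by
    rintro p _ rfl u v; rfl
  have hBsymm : ∀ p u v, B p u v = B p v u := fun p u v ↦ g'.symm (s p) _ _
  have hBpos : ∀ p v, v ≠ 0 → 0 < B p v v := fun p v hv ↦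
    g'.pos (s p) _ ((e (s p)).symm.map_ne_zero_iff.2 hv)
  clear_value B
  refine ⟨Metric.ofForms B hBsymm hBpos fun p ↦ ?_, hB⟩
  have hσp := (hf (s p)).localInverse_mem_source
  have hσs := (hf (s p)).localInverse_open_source
  have hσr := fun q ↦ (hf (s p)).localInverse_right_inv (y := q)
  have hσc := (hf (s p)).localInverse_contMDiffOn
  generalize (hf (s p)).localInverse = σ at *
  rw [hs] at hσp
  have hσ : ContMDiffAt (𝓡 n) (𝓡 n) ∞ σ p := hσc.contMDiffAt (hσs.mem_nhds hσp)
  refine (contMDiffAt_pullForm hσ (g'.contMDiff (σ p))).congr_of_eventuallyEq ?_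
  filter_upwards [hσs.mem_nhds hσp] with q hq
  congr 1
  ext u v
  -- The derivative of a local section inverts the derivative of `f`.
  have h4 : ∀ w : TangentSpace (𝓡 n) q,
      mfderiv (𝓡 n) (𝓡 n) f (σ q) (mfderiv (𝓡 n) (𝓡 n) σ q w) = w := by
    intro w
    have h5 := mfderiv_comp q (hf.mdifferentiable (by simp) (σ q))
      ((hσc.contMDiffAt (hσs.mem_nhds hq)).mdifferentiableAt (by simp))
    have h6 : (f ∘ σ) =ᶠ[𝓝 q] id := by
      filter_upwards [hσs.mem_nhds hq] with r hr using hσr r hr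
    rw [h6.mfderiv_eq, mfderiv_id] at h5
    exact (DFunLike.congr_fun h5 w).symm
  rw [pullForm_apply, hB, pullForm_apply]
  have h7 := hBeq _ _ (hσr q hq) u v
  rw [← h7]
  exact congrArg₂ (fun a b : Coord n ↦ B (f (σ q)) a b) (h4 u).symm (h4 v).symm

end Metrics

/-! ### Curvature under rescaling and local isometries -/

section Curvature

variable {n : ℕ}

theorem partialDeriv_congr {f f' : Coord n → ℝ} {y : Coord n} (h : f =ᶠ[𝓝 y] f') (i : Fin n) :
    partialDeriv i f y = partialDeriv i f' y := by
  rw [partialDeriv, partialDeriv, h.fderiv_eq]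

theorem partialDeriv_const_mul (c : ℝ) (f : Coord n → ℝ) (i : Fin n) (y : Coord n) :
    partialDeriv i (fun z ↦ c * f z) y = c * partialDeriv i f y := by
  have h : fderiv ℝ (fun z ↦ c * f z) y = c • fderiv ℝ f y :=
    congrFun (fderiv_const_smul_field c (f := f)) y
  rw [partialDeriv, h]
  rfl

theorem christoffel_congr {g g' : Coord n → Matrix (Fin n) (Fin n) ℝ} {y : Coord n}
    (h : g =ᶠ[𝓝 y] g') (k i j : Fin n) : christoffel g k i j y = christoffel g' k i j y := by
  have h' : ∀ a b, (fun z ↦ g z a b) =ᶠ[𝓝 y] fun z ↦ g' z a b := fun a b ↦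
    h.mono fun z hz ↦ by simp only [hz]
  simp only [christoffel, h.eq_of_nhds, partialDeriv_congr (h' _ _)]

theorem riemannComp_congr {g g' : Coord n → Matrix (Fin n) (Fin n) ℝ} {y : Coord n}
    (h : g =ᶠ[𝓝 y] g') (l k i j : Fin n) : riemannComp g l k i j y = riemannComp g' l k i j y := by
  have h' : ∀ a b c, christoffel g a b c =ᶠ[𝓝 y] christoffel g' a b c := fun a b c ↦
    h.eventuallyEq_nhds.mono fun z hz ↦ christoffel_congr hz a b c
  simp only [riemannComp, christoffel_congr h, partialDeriv_congr (h' _ _ _)]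

/-- Sectional curvature depends only on the germ of the metric. -/
theorem sectionalComp_congr {g g' : Coord n → Matrix (Fin n) (Fin n) ℝ} {y : Coord n}
    (h : g =ᶠ[𝓝 y] g') (u v : Coord n) : sectionalComp g y u v = sectionalComp g' y u v := by
  simp only [sectionalComp, curvatureQuad, innerComp, riemannComp_congr h, h.eq_of_nhds]

theorem christoffel_smul (g : Coord n → Matrix (Fin n) (Fin n) ℝ) {c : ℝ} (hc : c ≠ 0)
    (k i j : Fin n) : christoffel (fun z ↦ c • g z) k i j = christoffel g k i j := by
  funext y
  have hinv : (c • g y)⁻¹ = c⁻¹ • (g y)⁻¹ := by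
    by_cases hdet : IsUnit (g y).det
    · exact Matrix.inv_smul' _ (Units.mk0 c hc) hdet
    -- A singular matrix has inverse `0` by convention, which also scales.
    · rw [Matrix.nonsing_inv_apply_not_isUnit _ hdet, smul_zero,
        Matrix.nonsing_inv_apply_not_isUnit]
      rwa [Matrix.det_smul, IsUnit.mul_iff, and_iff_right ((Ne.isUnit hc).pow _)]
  simp only [christoffel, hinv, Matrix.smul_apply, smul_eq_mul, partialDeriv_const_mul]
  congr 1
  refine Finset.sum_congr rfl fun l _ ↦ ?_
  field_simp

theorem sectionalComp_smul (g : Coord n → Matrix (Fin n) (Fin n) ℝ) {c : ℝ} (hc : c ≠ 0)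
    (y u v : Coord n) :
    sectionalComp (fun z ↦ c • g z) y u v = c⁻¹ * sectionalComp g y u v := by
  have hR : ∀ l k i j, riemannComp (fun z ↦ c • g z) l k i j y = riemannComp g l k i j y := by
    intro l k i j
    simp only [riemannComp, christoffel_smul g hc]
  have hI : ∀ a b, innerComp (fun z ↦ c • g z) y a b = c * innerComp g y a b := by
    intro a b
    simp only [innerComp, Matrix.smul_apply, smul_eq_mul, Finset.mul_sum, mul_assoc]
  have hQ : curvatureQuad (fun z ↦ c • g z) y u v = c * curvatureQuad g y u v := by
    simp only [curvatureQuad, hR, Matrix.smul_apply, smul_eq_mul, Finset.mul_sum, mul_assoc]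
  rw [sectionalComp, sectionalComp, hI, hI, hI, hQ]
  rw [show c * innerComp g y u u * (c * innerComp g y v v) - (c * innerComp g y u v) ^ 2 =
    c * (c * (innerComp g y u u * innerComp g y v v - innerComp g y u v ^ 2)) by ring,
    mul_div_mul_left _ _ hc, div_mul_eq_div_div_swap, div_eq_inv_mul,
    div_eq_inv_mul]

variable {X Y : Type*} [TopologicalSpace X] [ChartedSpace (Coord n) X]
  [IsManifold (𝓡 n) ∞ X] [TopologicalSpace Y] [ChartedSpace (Coord n) Y]

/-- Charts are transported by partial diffeomorphisms. -/
theorem trans_mem_maximalAtlas (Φ : PartialDiffeomorph (𝓡 n) (𝓡 n) X Y ∞)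
    {e : OpenPartialHomeomorph Y (Coord n)} (he : e ∈ IsManifold.maximalAtlas (𝓡 n) ∞ Y) :
    Φ.toOpenPartialHomeomorph.trans e ∈ IsManifold.maximalAtlas (𝓡 n) ∞ X :=
  OpenPartialHomeomorph.mem_maximalAtlas_of_contMDiffOn _
    ((contMDiffOn_of_mem_maximalAtlas he).comp (Φ.contMDiffOn_toFun.mono inter_subset_left)
      inter_subset_right)
    (Φ.contMDiffOn_invFun.comp
      ((contMDiffOn_symm_of_mem_maximalAtlas he).mono inter_subset_left) inter_subset_right)

theorem HasConstantCurvature.scale {g : Metric n X} {κ : ℝ} (hg : HasConstantCurvature g κ) {c : ℝ}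
    (hc : 0 < c) : HasConstantCurvature (g.scale c hc) (c⁻¹ * κ) := by
  intro e he y hy u v huv
  rw [← hg e he y hy u v huv, ← sectionalComp_smul _ hc.ne']
  rfl

variable [IsManifold (𝓡 n) ∞ Y]

/-- A local isometry intertwines the coordinate expressions of the metrics, in charts that
correspond to each other. -/
theorem IsPullback.metricInChart_eventuallyEq {f : X → Y} {g' : Metric n X} {g : Metric n Y}
    (h : IsPullback f g' g) (hf : IsLocalDiffeomorph (𝓡 n) (𝓡 n) ∞ f)
    {e' : OpenPartialHomeomorph X (Coord n)} (he' : e' ∈ IsManifold.maximalAtlas (𝓡 n) ∞ X)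
    {e : OpenPartialHomeomorph Y (Coord n)} {y : Coord n} (hy : y ∈ e'.target)
    (hee' : e.symm =ᶠ[𝓝 y] f ∘ e'.symm) :
    metricInChart g' e' =ᶠ[𝓝 y] metricInChart g e := by
  filter_upwards [hee'.eventuallyEq_nhds, e'.open_target.mem_nhds hy] with z hz hze
  have hd : mfderiv (𝓡 n) (𝓡 n) e.symm z =
      (mfderiv (𝓡 n) (𝓡 n) f (e'.symm z)).comp (mfderiv (𝓡 n) (𝓡 n) e'.symm z) := by
    rw [hz.mfderiv_eq]
    exact mfderiv_comp z (hf.mdifferentiable (by simp) _)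
      ((contMDiffAt_symm_of_mem_maximalAtlas he' hze).mdifferentiableAt (by simp))
  ext i j
  simp only [metricInChart, Matrix.of_apply, hd, h (e'.symm z)]
  rw [hz.eq_of_nhds]
  rfl

theorem IsPullback.hasConstantCurvature {f : X → Y} {g' : Metric n X} {g : Metric n Y}
    (h : IsPullback f g' g) (hf : IsLocalDiffeomorph (𝓡 n) (𝓡 n) ∞ f) {κ : ℝ}
    (hg : HasConstantCurvature g κ) : HasConstantCurvature g' κ := by
  intro e he y hy u v huv
  obtain ⟨Φ, hxΦ, hΦ⟩ := hf (e.symm y)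
  have hev : (Φ.symm.toOpenPartialHomeomorph.trans e).symm =ᶠ[𝓝 y] f ∘ e.symm := by
    filter_upwards [(e.continuousAt_symm hy) (Φ.open_source.mem_nhds hxΦ)] with z hz
    exact (hΦ hz).symm
  rw [sectionalComp_congr (h.metricInChart_eventuallyEq hf he hy hev)]
  exact hg _ (trans_mem_maximalAtlas Φ.symm he) y ⟨hy, hxΦ⟩ u v huv

theorem IsPullback.hasConstantCurvature_of_surjective {f : X → Y} {g' : Metric n X}
    {g : Metric n Y} (h : IsPullback f g' g) (hf : IsLocalDiffeomorph (𝓡 n) (𝓡 n) ∞ f)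
    (hsurj : Function.Surjective f) {κ : ℝ} (hg : HasConstantCurvature g' κ) :
    HasConstantCurvature g κ := by
  intro e he y hy u v huv
  obtain ⟨x, hx⟩ := hsurj (e.symm y)
  obtain ⟨Φ, hxΦ, hΦ⟩ := hf x
  have hy' : y ∈ (Φ.toOpenPartialHomeomorph.trans e).target := by
    refine ⟨hy, ?_⟩
    change e.symm y ∈ Φ.target
    rw [← hx, hΦ hxΦ]
    exact Φ.map_source hxΦ
  have hev : e.symm =ᶠ[𝓝 y] f ∘ (Φ.toOpenPartialHomeomorph.trans e).symm := by
    filter_upwards [(Φ.toOpenPartialHomeomorph.trans e).open_target.mem_nhds hy'] with z hz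
    have hz' : e.symm z ∈ Φ.target := hz.2
    exact ((hΦ (Φ.map_target hz')).trans (Φ.right_inv hz')).symm
  rw [← sectionalComp_congr (h.metricInChart_eventuallyEq hf (trans_mem_maximalAtlas Φ he) hy' hev)]
  exact hg _ (trans_mem_maximalAtlas Φ he) y hy' u v huv

end Curvature

/-! ### Coverings and deck transformations -/

section Covering

/-- Fibres of a covering map may be empty, but the set of points with nonempty fibre is clopen. -/
theorem surjective_of_isCoveringMap {X Y : Type*} [TopologicalSpace X] [TopologicalSpace Y]
    [Nonempty X] [PreconnectedSpace Y] {f : X → Y} (hf : IsCoveringMap f) :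
    Function.Surjective f := by
  rw [← range_eq_univ]
  refine IsClopen.eq_univ ⟨?_, hf.isOpenMap.isOpen_range⟩ (range_nonempty f)
  rw [← isOpen_compl_iff, isOpen_iff_mem_nhds]
  intro y hy
  obtain ⟨-, U, hyU, hU, -, h, -⟩ := hf y
  filter_upwards [hU.mem_nhds hyU]
  rintro _ hx ⟨x, rfl⟩
  exact hy ⟨_, (h ⟨x, hx⟩).2.2⟩

variable {n : ℕ} {X Y : Type*} [TopologicalSpace X] [ChartedSpace (Coord n) X]
  [TopologicalSpace Y] [ChartedSpace (Coord n) Y]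

/-- A continuous lift of a local diffeomorphism through itself is smooth: locally it is the local
diffeomorphism followed by a local inverse. -/
theorem contMDiff_of_comp_isLocalDiffeomorph {f : X → Y}
    (hf : IsLocalDiffeomorph (𝓡 n) (𝓡 n) ∞ f) {F : X → X} (hF : Continuous F)
    (h : f ∘ F = f) : ContMDiff (𝓡 n) (𝓡 n) ∞ F := by
  intro x
  obtain ⟨Φ, hxΦ, hΦ⟩ := hf (F x)
  have h1 : ContMDiffAt (𝓡 n) (𝓡 n) ∞ Φ.symm (f x) := by
    refine Φ.contMDiffOn_invFun.contMDiffAt (Φ.open_target.mem_nhds ?_)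
    rw [← congrFun h x, Function.comp_apply, hΦ hxΦ]
    exact Φ.map_source hxΦ
  refine (h1.comp x (hf.contMDiff x)).congr_of_eventuallyEq ?_
  filter_upwards [hF.continuousAt (Φ.open_source.mem_nhds hxΦ)] with z hz
  have h2 : f z = Φ (F z) := (congrFun h z).symm.trans (hΦ hz)
  change F z = Φ.symm (f z)
  rw [h2]
  exact (Φ.left_inv hz).symm

/-- Deck transformations of a simply connected covering act transitively on the fibres. -/
theorem exists_mem_deckGroup_apply_eq [SimplyConnectedSpace X] {f : X → Y} (hcov : IsCoveringMap f)
    (hf : IsLocalDiffeomorph (𝓡 n) (𝓡 n) ∞ f) {x x' : X} (hxx' : f x = f x') :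
    ∃ φ ∈ deckGroup n f, φ x = x' := by
  have : LocallyPathConnectedSpace X := ChartedSpace.locallyPathConnectedSpace (Coord n) X
  obtain ⟨F, ⟨hFx, hF⟩, -⟩ :=
    hcov.existsUnique_continuousMap_lifts ⟨f, hcov.continuous⟩ (a₀ := x) (e₀ := x') hxx'.symm
  obtain ⟨G, ⟨hGx, hG⟩, -⟩ :=
    hcov.existsUnique_continuousMap_lifts ⟨f, hcov.continuous⟩ (a₀ := x') (e₀ := x) hxx'
  have hF' : f ∘ F = f := hF
  have hG' : f ∘ G = f := hG
  have hGF : G ∘ F = id := hcov.eq_of_comp_eq (G.continuous.comp F.continuous) continuous_id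
    (by rw [← Function.comp_assoc, hG', hF', Function.comp_id]) x (by simp [hFx, hGx])
  have hFG : F ∘ G = id := hcov.eq_of_comp_eq (F.continuous.comp G.continuous) continuous_id
    (by rw [← Function.comp_assoc, hF', hG', Function.comp_id]) x' (by simp [hFx, hGx])
  exact ⟨{  toFun := F
            invFun := G
            left_inv := congrFun hGF
            right_inv := congrFun hFG
            contMDiff_toFun := contMDiff_of_comp_isLocalDiffeomorph hf F.continuous hF'
            contMDiff_invFun := contMDiff_of_comp_isLocalDiffeomorph hf G.continuous hG' },
    congrFun hF', hFx⟩

end Covering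

/-! ### Completeness of coverings of compact manifolds -/

section Complete

variable {n : ℕ} {X Y : Type*} [TopologicalSpace X] [ChartedSpace (Coord n) X]
  [IsManifold (𝓡 n) ∞ X] [TopologicalSpace Y] [ChartedSpace (Coord n) Y] [IsManifold (𝓡 n) ∞ Y]

theorem riemDist_triangle (g : Metric n X) (x y z : X) :
    riemDist g x z ≤ riemDist g x y + riemDist g y z := by
  let : RiemannianBundle (fun x : X ↦ TangentSpace (𝓡 n) x) := ⟨g.toRiemannianMetric⟩
  exact riemannianEDist_triangle

theorem eventually_riemDist_lt (g : Metric n X) (x : X) {c : ℝ≥0∞} (hc : 0 < c) :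
    ∀ᶠ y in 𝓝 x, riemDist g x y < c := by
  let : RiemannianBundle (fun x : X ↦ TangentSpace (𝓡 n) x) := ⟨g.toRiemannianMetric⟩
  have : IsContinuousRiemannianBundle (Coord n) (fun x : X ↦ TangentSpace (𝓡 n) x) :=
    ⟨⟨g.inner, g.contMDiff.continuous, fun _ _ _ ↦ rfl⟩⟩
  have : IsManifold (𝓡 n) 1 X := .of_le (n := ∞) (by simp)
  exact eventually_riemannianEDist_lt (𝓡 n) x hc

theorem exists_riemDist_lt_subset [T2Space X] (g : Metric n X) {x : X} {s : Set X} (hs : s ∈ 𝓝 x) :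
    ∃ c > 0, {y | riemDist g x y < c} ⊆ s := by
  let : RiemannianBundle (fun x : X ↦ TangentSpace (𝓡 n) x) := ⟨g.toRiemannianMetric⟩
  have : IsContinuousRiemannianBundle (Coord n) (fun x : X ↦ TangentSpace (𝓡 n) x) :=
    ⟨⟨g.inner, g.contMDiff.continuous, fun _ _ _ ↦ rfl⟩⟩
  have : IsManifold (𝓡 n) 1 X := .of_le (n := ∞) (by simp)
  have : LocallyCompactSpace X := ChartedSpace.locallyCompactSpace (Coord n) X
  exact setOfPred_riemannianEDist_lt_subset_nhds' (𝓡 n) hs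

/-- Two points at distance less than `r` are joined by a path whose image under a local isometry
stays in the ball of radius `r` around the image of the first point. -/
theorem IsPullback.exists_path {f : X → Y} (hf : IsLocalDiffeomorph (𝓡 n) (𝓡 n) ∞ f)
    {g' : Metric n X} {g : Metric n Y} (h : IsPullback f g' g) {x x' : X} {r : ℝ≥0∞}
    (hr : riemDist g' x x' < r) :
    ∃ γ : ℝ → X, Continuous γ ∧ γ 0 = x ∧ γ 1 = x' ∧
      ∀ t ∈ Icc (0 : ℝ) 1, riemDist g (f x) (f (γ t)) < r := by
  let : RiemannianBundle (fun x : X ↦ TangentSpace (𝓡 n) x) := ⟨g'.toRiemannianMetric⟩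
  let : RiemannianBundle (fun y : Y ↦ TangentSpace (𝓡 n) y) := ⟨g.toRiemannianMetric⟩
  obtain ⟨γ, hγ0, hγ1, hγ, hlen, -⟩ :=
    exists_lt_locally_constant_of_riemannianEDist_lt (I := 𝓡 n) hr zero_lt_one
  refine ⟨γ, hγ.continuous, hγ0, hγ1, fun t ht ↦ ?_⟩
  have hiso : ∀ (z : X) (v : TangentSpace (𝓡 n) z), ‖mfderiv (𝓡 n) (𝓡 n) f z v‖ₑ = ‖v‖ₑ := by
    intro z v
    have h1 : ‖mfderiv (𝓡 n) (𝓡 n) f z v‖ ^ 2 = ‖v‖ ^ 2 := by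
      rw [← real_inner_self_eq_norm_sq, ← real_inner_self_eq_norm_sq]
      exact (DFunLike.congr_fun (DFunLike.congr_fun (h z) v) v).symm
    have h2 : ‖mfderiv (𝓡 n) (𝓡 n) f z v‖ = ‖v‖ :=
      (sq_eq_sq₀ (norm_nonneg _) (norm_nonneg _)).1 h1
    rw [← ofReal_norm, ← ofReal_norm, h2]
  have hlen' : pathELength (𝓡 n) (f ∘ γ) 0 t = pathELength (𝓡 n) γ 0 t := by
    simp only [pathELength_eq_lintegral_mfderiv_Icc]
    congr 1
    ext s
    rw [mfderiv_comp s (hf.mdifferentiable (by simp) _) (hγ.mdifferentiable (by simp) s)]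
    exact hiso _ _
  calc riemannianEDist (𝓡 n) (f x) (f (γ t)) ≤ pathELength (𝓡 n) (f ∘ γ) 0 t :=
        riemannianEDist_le_pathELength
          (((hf.contMDiff.of_le (by simp)).comp hγ).contMDiffOn) (by simp [hγ0]) rfl ht.1
    _ = pathELength (𝓡 n) γ 0 t := hlen'
    _ ≤ pathELength (𝓡 n) γ 0 1 := pathELength_mono le_rfl ht.2
    _ < r := hlen

/-- A Riemannian covering of a compact manifold is complete: the image of a Cauchy sequence
accumulates at some point `p`, and from some index on the sequence stays in a single sheet over an
evenly covered neighbourhood of `p`. -/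
theorem IsPullback.isCompleteMetric [T2Space Y] [CompactSpace Y] {f : X → Y}
    (hcov : IsCoveringMap f) (hf : IsLocalDiffeomorph (𝓡 n) (𝓡 n) ∞ f)
    {g' : Metric n X} {g : Metric n Y} (h : IsPullback f g' g) : IsCompleteMetric g' := by
  intro s hs
  obtain ⟨p, hp⟩ := exists_clusterPt_of_compactSpace (map (f ∘ s) atTop)
  have hp : MapClusterPt p atTop (f ∘ s) := hp
  -- From some index on, the sequence moves along paths that lie over a given neighbourhood of `p`.
  have key : ∀ V ∈ 𝓝 p, ∃ j, ∀ i ≥ j, ∃ γ : ℝ → X, Continuous γ ∧ γ 0 = s j ∧ γ 1 = s i ∧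
      ∀ t ∈ Icc (0 : ℝ) 1, f (γ t) ∈ V := by
    intro V hV
    obtain ⟨c, hc, hcV⟩ := exists_riemDist_lt_subset g hV
    have hc2 : 0 < c / 2 := ENNReal.half_pos hc.ne'
    obtain ⟨N, hN⟩ := hs _ hc2
    obtain ⟨j, hj, hjN⟩ := ((hp.frequently (eventually_riemDist_lt g p hc2)).and_eventually
      (eventually_ge_atTop N)).exists
    refine ⟨j, fun i hi ↦ ?_⟩
    obtain ⟨γ, hγ, h0, h1, hγV⟩ := h.exists_path hf (hN j hjN i (hjN.trans hi))
    refine ⟨γ, hγ, h0, h1, fun t ht ↦ hcV ?_⟩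
    calc riemDist g p (f (γ t)) ≤ riemDist g p (f (s j)) + riemDist g (f (s j)) (f (γ t)) :=
          riemDist_triangle _ _ _ _
      _ < c / 2 + c / 2 := ENNReal.add_lt_add hj (hγV t ht)
      _ = c := ENNReal.add_halves c
  have hlim : Tendsto (f ∘ s) atTop (𝓝 p) := by
    intro V hV
    obtain ⟨j, hj⟩ := key V hV
    rw [mem_map]
    filter_upwards [eventually_ge_atTop j] with i hi
    obtain ⟨γ, -, -, h1, hγV⟩ := hj i hi
    have := hγV 1 (by simp)
    rwa [h1] at this
  obtain ⟨hdisc, U, hpU, hU, hfU, e, he⟩ := hcov p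
  obtain ⟨j, hj⟩ := key U (hU.mem_nhds hpU)
  have hsU : ∀ i ≥ j, s i ∈ f ⁻¹' U := by
    intro i hi
    obtain ⟨γ, -, -, h1, hγV⟩ := hj i hi
    have := hγV 1 (by simp)
    rwa [h1] at this
  -- The sheet is a continuous function on each path, with values in a discrete space.
  have hsheet : ∀ i (hi : i ≥ j), (e ⟨s i, hsU i hi⟩).2 = (e ⟨s j, hsU j le_rfl⟩).2 := by
    intro i hi
    obtain ⟨γ, hγ, h0, h1, hγV⟩ := hj i hi
    let c : unitInterval → f ⁻¹' {p} := fun t ↦ (e ⟨γ t, hγV t t.2⟩).2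
    have hc : Continuous c := by fun_prop
    have hc01 : c 1 = c 0 := PreconnectedSpace.constant inferInstance hc
    simpa [c, h0, h1] using hc01
  refine ⟨e.symm (⟨p, hpU⟩, (e ⟨s j, hsU j le_rfl⟩).2), ?_⟩
  rw [← tendsto_add_atTop_iff_nat j]
  have hs' : ∀ i, s (i + j) = e.symm (⟨f (s (i + j)), hsU _ (Nat.le_add_left j i)⟩,
      (e ⟨s j, hsU j le_rfl⟩).2) := by
    intro i
    have h1 : e ⟨s (i + j), hsU _ (Nat.le_add_left j i)⟩ =
        (⟨f (s (i + j)), hsU _ (Nat.le_add_left j i)⟩, (e ⟨s j, hsU j le_rfl⟩).2) :=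
      Prod.ext (Subtype.ext (he _)) (hsheet _ (Nat.le_add_left j i))
    rw [← h1, e.symm_apply_apply]
  rw [funext hs']
  have hlim' : Tendsto (fun i ↦ (⟨f (s (i + j)), hsU _ (Nat.le_add_left j i)⟩ : U)) atTop
      (𝓝 ⟨p, hpU⟩) :=
    tendsto_subtype_rng.2 ((tendsto_add_atTop_iff_nat j).2 hlim)
  exact (continuous_subtype_val.tendsto _).comp
    ((e.symm.continuous.tendsto _).comp (hlim'.prodMk_nhds tendsto_const_nhds))

end Complete

/-! ### Metrics of constant negative curvature and the universal covering -/

section Hyperbolic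

variable {n : ℕ} {X Y : Type*} [TopologicalSpace X] [ChartedSpace (Coord n) X]
  [IsManifold (𝓡 n) ∞ X] [TopologicalSpace Y] [ChartedSpace (Coord n) Y] [IsManifold (𝓡 n) ∞ Y]

/-- A metric of constant negative curvature on a compact manifold, rescaled to curvature `-1` and
pulled back to a covering, is hyperbolic and invariant under deck transformations. -/
theorem HasConstantNegativeCurvature.exists_isHyperbolic [T2Space Y] [CompactSpace Y] {f : X → Y}
    (hcov : IsCoveringMap f) (hf : IsLocalDiffeomorph (𝓡 n) (𝓡 n) ∞ f) {g : Metric n Y}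
    (hg : HasConstantNegativeCurvature g) :
    ∃ g' : Metric n X, IsHyperbolic g' ∧ IsInvariant (deckGroup n f) g' := by
  obtain ⟨κ, hκ, hg⟩ := hg
  have hg1 : HasConstantCurvature (g.scale (-κ) (neg_pos.2 hκ)) (-1) := by
    have h := hg.scale (neg_pos.2 hκ)
    rwa [inv_neg, neg_mul, inv_mul_cancel₀ hκ.ne] at h
  obtain ⟨g', hg'⟩ := exists_isPullback hf (g.scale (-κ) (neg_pos.2 hκ))
  exact ⟨g', ⟨hg'.isCompleteMetric hcov hf, hg'.hasConstantCurvature hf hg1⟩,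
    fun φ hφ ↦ hg'.preserves_of_comp_eq hf hφ⟩

end Hyperbolic

end NegCurv

theorem mainTheorem5 (n : ℕ)
    {M : Type*} [TopologicalSpace M] [T2Space M] [CompactSpace M] [ConnectedSpace M]
    [ChartedSpace (NegCurv.Coord n) M] [IsManifold (𝓡 n) ∞ M]
    (g : NegCurv.Metric n M) (hg : NegCurv.HasNegativeCurvature g)
    {M' : Type*} [TopologicalSpace M'] [T2Space M'] [SimplyConnectedSpace M']
    [ChartedSpace (NegCurv.Coord n) M'] [IsManifold (𝓡 n) ∞ M']
    (proj : M' → M) (hcov : IsCoveringMap proj) (hproj : IsLocalDiffeomorph (𝓡 n) (𝓡 n) ∞ proj) :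
    List.TFAE [
      ∃ g₁ : NegCurv.Metric n M, NegCurv.HasConstantNegativeCurvature g₁,
      ∃ gH : NegCurv.Metric n M', NegCurv.IsHyperbolic gH ∧
        NegCurv.IsInvariant (NegCurv.deckGroup n proj) gH,
      ∃ gH : NegCurv.Metric n M', NegCurv.IsHyperbolic gH ∧
        NegCurv.deckGroup n proj ≤ NegCurv.isometryGroup gH,
      ∃ g₁ : NegCurv.Metric n M, NegCurv.HasConstantNegativeCurvature g₁ ∧
        ∃ h : unitInterval → NegCurv.Metric n M, NegCurv.IsSmoothHomotopy h g g₁,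
      ∃ gH : NegCurv.Metric n M', NegCurv.IsHyperbolic gH ∧
        ∀ k : NegCurv.Metric n M', NegCurv.IsInvariant (NegCurv.deckGroup n proj) k →
          ∃ h : unitInterval → NegCurv.Metric n M', NegCurv.IsSmoothHomotopy h k gH ∧
            ∀ t, NegCurv.IsInvariant (NegCurv.deckGroup n proj) (h t)] := by
  have hsurj : Function.Surjective proj := NegCurv.surjective_of_isCoveringMap hcov
  tfae_have 1 → 2 := fun ⟨_, hg₁⟩ ↦ hg₁.exists_isHyperbolic hcov hproj
  tfae_have 2 ↔ 3 := Iff.rfl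
  tfae_have 2 → 1 := by
    rintro ⟨gH, hH, hinv⟩
    obtain ⟨g₁, hg₁⟩ := NegCurv.exists_isPullback_of_invariant hproj hsurj
      (fun _ _ h ↦ NegCurv.exists_mem_deckGroup_apply_eq hcov hproj h) hinv
    exact ⟨g₁, -1, by norm_num, hg₁.hasConstantCurvature_of_surjective hproj hsurj hH.2⟩
  tfae_have 1 → 4 := fun ⟨g₁, hg₁⟩ ↦
    ⟨g₁, hg₁, g.convexComb g₁, NegCurv.isSmoothHomotopy_convexComb g g₁⟩
  tfae_have 4 → 1 := fun ⟨g₁, hg₁, _⟩ ↦ ⟨g₁, hg₁⟩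
  tfae_have 2 → 5 := fun ⟨gH, hH, hinv⟩ ↦ ⟨gH, hH, fun k hk ↦ ⟨k.convexComb gH,
    NegCurv.isSmoothHomotopy_convexComb k gH, fun t φ hφ ↦ (hk φ hφ).convexComb (hinv φ hφ) t⟩⟩
  tfae_have 5 → 2 := by
    -- The pullback of `g` is invariant; the endpoint of its homotopy is the hyperbolic metric.
    rintro ⟨gH, hH, hhom⟩
    obtain ⟨k, hk⟩ := NegCurv.exists_isPullback hproj g
    obtain ⟨h, hh, hinv⟩ := hhom k fun φ hφ ↦ hk.preserves_of_comp_eq hproj hφ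
    exact ⟨gH, hH, hh.one ▸ hinv 1⟩
  tfae_finish
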